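/- Let $J,M,s,L$ be natural numbers with $1\le s<M$. For $j=1,\dots,J$ let $D_j\in\mathbb R^{N_j\times M}$ (a dictionary, whose columns are called atoms), $X_j=[x_j^1,\dots,x_j^L]\in\mathbb R^{M\times L}$ and $Y_j=D_jX_j=[y_j^1,\dots,y_j^L]$. Let $\operatorname{spark}(D_j)$ be the minimum number of linearly dependent columns of $D_j$ ($\infty$ if the columns are linearly independent), and say that $y_j^i$ is generated by the atoms of $D_j$ whose indices form the support of $x_j^i$. Consider the following assumptions on the modality $j$: 1. every $x_j^i$ has exactly $s$ nonzero entries, and $s<\operatorname{spark}(D_j)/2$; 2. for every set of $s$ atoms of $D_j$, $Y_j$ contains at least $s+1$ different points generated by exactly these atoms; 3. every group of $s+1$ different points of $Y_j$ that are all generated by the same $s$ atoms has rank exactly $s$, and every group of $s+1$ different points of $Y_j$ that are not all generated by the same $s$ atoms has rank exactly $s+1$. (i) If Assumptions 1–3 hold for every $j$, then for every $j$ the factorization $Y_j=D_jX_j$ is unique up to permutation and scaling: whenever $Y_j=D'X'$ with $D'\in\mathbb R^{N_j\times M}$ and $X'\in\mathbb R^{M\times L}$ each of whose columns has at most $s$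 nonzero entries, there is a matrix $Z$, the product of a permutation matrix and an invertible diagonal matrix, such that $D'=D_jZ$ and $X_j=ZX'$. (ii) The minimum total number of samples (the number $JL$ of data points over all modalities) for which this guarantee applies is $J(s+1)\binom Ms$: Assumptions 1–3 for all $j$ force $JL\ge J(s+1)\binom Ms$; and whenever $s<\operatorname{spark}(D_j)/2$ for all $j$, the number $J(s+1)\binom Ms$ is the least value of $JL$ over all $L$ and all $X_1,\dots,X_J\in\mathbb R^{M\times L}$ such that Assumptions 1–3 hold for all $j$ and, for each $i$, the vectors $x_1^i,\dots,x_J^i$ have the same support. -/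

import Mathlib

namespace DictLearning

/-- The spark of a matrix: the least number of linearly dependent columns
(`⊤` if the columns are linearly independent). -/
noncomputable def spark {N M : ℕ} (D : Matrix (Fin N) (Fin M) ℝ) : ℕ∞ :=
  sInf {n : ℕ∞ | ∃ S : Finset (Fin M),
    (S.card : ℕ∞) = n ∧ ¬ LinearIndependent ℝ (fun m : S => D.col (m : Fin M))}

/-- Every code has exactly `s` nonzero entries, and `s < spark D / 2`. -/
def SparsityAssumption {N M L : ℕ} (s : ℕ) (D : Matrix (Fin N) (Fin M) ℝ)
    (X : Matrix (Fin M) (Fin L) ℝ) : Prop :=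
  (∀ i, hammingNorm (X.col i) = s) ∧ 2 * (s : ℕ∞) < spark D

/-- For every set `S` of `s` atoms, the data contain at least `s + 1` different points that are
generated by exactly the atoms in `S`. -/
def RichnessAssumption {N M L : ℕ} (s : ℕ) (Y : Matrix (Fin N) (Fin L) ℝ)
    (X : Matrix (Fin M) (Fin L) ℝ) : Prop :=
  ∀ S : Finset (Fin M), S.card = s →
    s + 1 ≤ (Y.col '' {i | Function.support (X.col i) = (S : Set (Fin M))}).ncard

/-- The data points with indices in `I` are all generated by the same atoms. -/
def SameAtoms {M L : ℕ} (X : Matrix (Fin M) (Fin L) ℝ) (I : Finset (Fin L)) : Prop :=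
  ∀ i ∈ I, ∀ k ∈ I, Function.support (X.col i) = Function.support (X.col k)

/-- Every group of `s + 1` different data points has rank exactly `s` if all of them are generated
by the same atoms, and rank exactly `s + 1` otherwise. -/
def NondegeneracyAssumption {N M L : ℕ} (s : ℕ) (Y : Matrix (Fin N) (Fin L) ℝ)
    (X : Matrix (Fin M) (Fin L) ℝ) : Prop :=
  ∀ I : Finset (Fin L), I.card = s + 1 → Set.InjOn Y.col (I : Set (Fin L)) →
    (SameAtoms X I → Set.finrank ℝ (Y.col '' (I : Set (Fin L))) = s) ∧
    (¬ SameAtoms X I → Set.finrank ℝ (Y.col '' (I : Set (Fin L))) = s + 1)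

/-- The three assumptions on one modality, with data `Y = D * X`. -/
def Assumptions {N M L : ℕ} (s : ℕ) (D : Matrix (Fin N) (Fin M) ℝ)
    (X : Matrix (Fin M) (Fin L) ℝ) : Prop :=
  SparsityAssumption s D X ∧ RichnessAssumption s (D * X) X ∧
    NondegeneracyAssumption s (D * X) X

/-- `Y = D * X`, where every column of `X` has at most `s` nonzero entries. -/
def IsSparseFactorization {N M L : ℕ} (s : ℕ) (Y : Matrix (Fin N) (Fin L) ℝ)
    (D : Matrix (Fin N) (Fin M) ℝ) (X : Matrix (Fin M) (Fin L) ℝ) : Prop :=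
  Y = D * X ∧ ∀ i, hammingNorm (X.col i) ≤ s

/-- A permutation and scaling matrix. -/
def IsPermScaling {M : ℕ} (Z : Matrix (Fin M) (Fin M) ℝ) : Prop :=
  ∃ (σ : Equiv.Perm (Fin M)) (c : Fin M → ℝ),
    (∀ m, c m ≠ 0) ∧ Z = σ.permMatrix ℝ * Matrix.diagonal c

/-- `D * X` is an `s`-sparse factorization of `Y`, and every other one with the same number of
atoms arises from it by permuting and scaling the atoms. -/
def IsUniqueFactorization {N M L : ℕ} (s : ℕ) (Y : Matrix (Fin N) (Fin L) ℝ)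
    (D : Matrix (Fin N) (Fin M) ℝ) (X : Matrix (Fin M) (Fin L) ℝ) : Prop :=
  IsSparseFactorization s Y D X ∧
    ∀ (D' : Matrix (Fin N) (Fin M) ℝ) (X' : Matrix (Fin M) (Fin L) ℝ),
      IsSparseFactorization s Y D' X' →
        ∃ Z : Matrix (Fin M) (Fin M) ℝ, IsPermScaling Z ∧ D' = D * Z ∧ X = Z * X'

/-- For each instance `i`, the codes of all modalities have the same support. -/
def CommonSparsityProfile {J M L : ℕ} (X : Fin J → Matrix (Fin M) (Fin L) ℝ) : Prop :=
  ∀ i j j', Function.support ((X j).col i) = Function.support ((X j').col i)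

end DictLearning

/-!
Uniqueness: colour each sample by the support of its code in `X` and by a set of `s` atoms of `D'`
containing the support of its code in `X'`. Samples of one `D'`-colour lie in a space of dimension
`s`, so by nondegeneracy any `s + 1` of them have the same `D`-colour. When every `D`-colour occurs
exactly `s + 1` times, counting shows that the `D`-colour is an injective function `φ` of the
`D'`-colour and that the atoms of `D'` in `p` span the same space as the atoms of `D` in `φ p`. An
atom of `D'` thus lies in the span of the atoms of `D` in `φ p` for every `p` containing it. Since
sparse codes over `D` are unique, all these sets contain the support of its code over `D`; counting
the sets shows that this support is a single atom and that distinct atoms of `D'` have distinct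
ones.

Sharpness: the samples are chosen one at a time. Each must avoid finitely many subspaces, none of
which contains the span of the atoms that are to generate it, and a vector space over an infinite
field is not a finite union of proper subspaces.
-/

namespace DictLearning

open Module Matrix
open scoped Finset

section Combinatorics

variable {α β ι : Type*} {s : ℕ}

theorem card_filter_mem_powersetCard [Fintype α] [DecidableEq α] (hs : 0 < s) (a : α) :
    #{p : Set.powersetCard α s | a ∈ (p : Finset α)} =
      (Fintype.card α - 1).choose (s - 1) := by
  have h := Finset.card_filter_powersetCard_subset {a} Finset.univ s (Finset.subset_univ _)
    (by rw [Finset.card_singleton]; exact hs)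
  rw [Finset.card_singleton, Finset.card_univ] at h
  rw [← h, ← Finset.card_map (Function.Embedding.subtype _)]
  congr 1
  ext S
  simp [Set.powersetCard.mem_iff, and_comm]

/-- Injectivity of `φ` turns the implication into an equivalence because `a` and `b` lie in equally
many sets of size `s`. -/
theorem mem_iff_mem_of_forall_mem_imp_mem [Finite α] {a b : α}
    {φ : Set.powersetCard α s → Set.powersetCard α s} (hφ : Function.Injective φ) (hs : 0 < s)
    (h : ∀ p, a ∈ p → b ∈ φ p) (p : Set.powersetCard α s) : a ∈ p ↔ b ∈ φ p := by
  classical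
  have := Fintype.ofFinite α
  let containing (c : α) : Finset (Set.powersetCard α s) := {q | c ∈ (q : Finset α)}
  have mem_containing {c : α} {q : Set.powersetCard α s} : q ∈ containing c ↔ c ∈ q :=
    Finset.mem_filter_univ q
  have image_eq : (containing a).image φ = containing b := by
    refine Finset.eq_of_subset_of_card_le (Finset.image_subset_iff.2 fun q hq => ?_) ?_
    · exact mem_containing.2 (h q (mem_containing.1 hq))
    · rw [Finset.card_image_of_injective _ hφ, card_filter_mem_powersetCard hs,
        card_filter_mem_powersetCard hs]
  refine ⟨h p, fun hb => ?_⟩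
  obtain ⟨q, hq, hqp⟩ := Finset.mem_image.1 (image_eq ▸ mem_containing.2 hb)
  exact hφ hqp ▸ mem_containing.1 hq

theorem exists_perm_forall_eq_singleton [Finite α] (hs : 0 < s) (hsα : s < Nat.card α)
    {φ : Set.powersetCard α s → Set.powersetCard α s} (hφ : Function.Injective φ)
    {A : α → Set α} (hne : ∀ a, (A a).Nonempty) (hA : ∀ a p, a ∈ p → ∀ b ∈ A a, b ∈ φ p) :
    ∃ σ : Equiv.Perm α, ∀ a, A a = {σ a} := by
  choose π hπ using hne
  have mem_iff : ∀ a p, a ∈ p ↔ π a ∈ φ p := fun a =>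
    mem_iff_mem_of_forall_mem_imp_mem hφ hs fun p hp => hA a p hp _ (hπ a)
  have exists_separating : ∀ {a b : α}, a ≠ b → ∃ p : Set.powersetCard α s, a ∈ p ∧ b ∉ p :=
    Set.powersetCard.exists_mem_notMem hs (by simpa [ENat.card_eq_coe_natCard] using hsα)
  have injective : Function.Injective π := by
    intro a b hab
    by_contra hne
    obtain ⟨p, ha, hb⟩ := exists_separating hne
    exact hb ((mem_iff b p).2 (hab ▸ (mem_iff a p).1 ha))
  have bijective : Function.Bijective π := Finite.injective_iff_bijective.1 injective
  refine ⟨Equiv.ofBijective π bijective, fun a => ?_⟩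
  refine Set.eq_singleton_iff_unique_mem.2 ⟨hπ a, fun c hc => ?_⟩
  obtain ⟨b, rfl⟩ := bijective.surjective c
  by_contra hne
  obtain ⟨p, ha, hb⟩ := exists_separating fun hab : a = b => hne (hab ▸ rfl)
  exact hb ((mem_iff b p).2 (hA a p ha _ hc))

theorem eq_of_forall_card_eq_imp_eq {f : ι → β} {n : ℕ} (hn : 2 ≤ n) {F : Finset ι}
    (hF : n ≤ #F) (h : ∀ I ⊆ F, #I = n → ∀ i ∈ I, ∀ k ∈ I, f i = f k) {i k : ι}
    (hi : i ∈ F) (hk : k ∈ F) : f i = f k := by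
  classical
  obtain ⟨I, hikI, hIF, hI⟩ := Finset.exists_subsuperset_card_eq
    (show {i, k} ⊆ F by simp [Finset.insert_subset_iff, hi, hk]) (Finset.card_le_two.trans hn) hF
  exact h I hIF hI i (hikI (by simp)) k (hikI (by simp))

theorem exists_injective_forall_eq_apply [Fintype ι] [Finite β] [DecidableEq β] {f g : ι → β}
    {n : ℕ} (hn : 2 ≤ n) (hf : ∀ b, #{i | f i = b} = n)
    (hfg : ∀ I : Finset ι, #I = n → (∀ i ∈ I, ∀ k ∈ I, g i = g k) →
      ∀ i ∈ I, ∀ k ∈ I, f i = f k) :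
    ∃ φ : β → β, Function.Injective φ ∧ ∀ i, f i = φ (g i) := by
  have := Fintype.ofFinite β
  let fiber (h : ι → β) (b : β) : Finset ι := {i | h i = b}
  have subset_fiber : ∀ b, n ≤ #(fiber g b) → ∃ c, fiber g b ⊆ fiber f c := by
    intro b hb
    obtain ⟨i, hi⟩ := Finset.card_pos.1 ((Nat.zero_lt_of_lt hn).trans_le hb)
    refine ⟨f i, fun k hk => (Finset.mem_filter_univ k).2 ?_⟩
    exact eq_of_forall_card_eq_imp_eq hn hb (fun I hI hIn => hfg I hIn fun i hi k hk =>
      (Finset.mem_filter.1 (hI hi)).2.trans (Finset.mem_filter.1 (hI hk)).2.symm) hk hi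
  have card_le : ∀ b ∈ Finset.univ, #(fiber g b) ≤ n := by
    intro b _
    by_contra! hlt
    obtain ⟨c, hc⟩ := subset_fiber b hlt.le
    exact absurd ((Finset.card_le_card hc).trans (hf c).le) hlt.not_ge
  have sum_card : ∑ b, #(fiber g b) = ∑ _b : β, n := by
    rw [← Finset.card_eq_sum_card_fiberwise fun _ _ => Finset.mem_coe.2 (Finset.mem_univ _),
      Finset.card_eq_sum_card_fiberwise (f := f) fun _ _ => Finset.mem_coe.2 (Finset.mem_univ _)]
    simp only [hf]
  have card_eq : ∀ b, #(fiber g b) = n := fun b =>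
    (Finset.sum_eq_sum_iff_of_le card_le).1 sum_card b (Finset.mem_univ b)
  choose φ hφ using fun b => subset_fiber b (card_eq b).ge
  have fiber_eq : ∀ b, fiber g b = fiber f (φ b) := fun b =>
    Finset.eq_of_subset_of_card_le (hφ b) ((hf _).trans (card_eq b).symm).le
  refine ⟨φ, fun b c hbc => ?_, fun i => (Finset.mem_filter.1 (hφ (g i) ?_)).2⟩
  · obtain ⟨i, hi⟩ := Finset.card_pos.1 ((Nat.zero_lt_of_lt hn).trans_eq (card_eq b).symm)
    have hic : i ∈ fiber g c := by rwa [fiber_eq c, ← hbc, ← fiber_eq b]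
    exact (Finset.mem_filter.1 hi).2.symm.trans (Finset.mem_filter.1 hic).2
  · exact (Finset.mem_filter_univ i).2 rfl

end Combinatorics

section LinearAlgebra

variable {K V ι κ : Type*}

theorem linearIndepOn_finset_iff_finrank_eq [DivisionRing K] [AddCommGroup V] [Module K V]
    {y : ι → V} {I : Finset ι} :
    LinearIndepOn K y (I : Set ι) ↔ Set.finrank K (y '' I) = #I := by
  rw [LinearIndepOn, linearIndependent_iff_card_eq_finrank_span, Set.image_eq_range, eq_comm]
  simp

theorem finrank_image_finset_le [DivisionRing K] [AddCommGroup V] [Module K V]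
    (y : ι → V) (I : Finset ι) : Set.finrank K (y '' I) ≤ #I := by
  classical
  rw [← Finset.coe_image]
  exact (finrank_span_finset_le_card _).trans Finset.card_image_le

theorem span_image_eq_span_image_of_finrank_eq [DivisionRing K] [AddCommGroup V] [Module K V]
    {y : ι → V} {a : κ → V} {I : Set ι} {S : Finset κ}
    (hy : ∀ i ∈ I, y i ∈ Submodule.span K (a '' S)) (hI : Set.finrank K (y '' I) = #S) :
    Submodule.span K (y '' I) = Submodule.span K (a '' S) := by
  have := FiniteDimensional.span_of_finite K (S.finite_toSet.image a)
  exact Submodule.eq_of_le_of_finrank_le (Submodule.span_le.2 (Set.image_subset_iff.2 hy))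
    ((finrank_image_finset_le a S).trans_eq hI.symm)

theorem finrank_image_le_card_of_forall_mem_span [DivisionRing K] [AddCommGroup V] [Module K V]
    {y : ι → V} {a : κ → V} {I : Set ι} {S : Finset κ}
    (hy : ∀ i ∈ I, y i ∈ Submodule.span K (a '' S)) : Set.finrank K (y '' I) ≤ #S := by
  have := FiniteDimensional.span_of_finite K (S.finite_toSet.image a)
  exact (Submodule.finrank_mono (Submodule.span_le.2 (Set.image_subset_iff.2 hy))).trans
    (finrank_image_finset_le a S)

/-- Scaling a vector that avoids the subspaces keeps it out of them, and it takes infinitely many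
values, so that the finite set `E` is avoided as well. -/
theorem exists_mem_forall_notMem [DivisionRing K] [Infinite K] [AddCommGroup V] [Module K V]
    {W : Submodule K V} (hW : W ≠ ⊥) {B : Finset (Submodule K V)} (hB : ∀ U ∈ B, ¬ W ≤ U)
    (E : Finset V) : ∃ y ∈ W, (∀ U ∈ B, y ∉ U) ∧ y ∉ E := by
  classical
  have top_notMem : ⊤ ∉ (insert ⊥ B).image (Submodule.comap W.subtype) := by
    simp only [Finset.mem_image, Finset.mem_insert, Submodule.comap_subtype_eq_top, not_exists,
      not_and]
    rintro U (rfl | hU)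
    · simpa using hW
    · exact hB U hU
  obtain ⟨y, hy⟩ := (Set.ne_univ_iff_exists_notMem _).1
    (Subspace.biUnion_ne_univ_of_top_notMem top_notMem)
  have y_notMem : ∀ U ∈ insert ⊥ B, (y : V) ∉ U := by simpa using hy
  have y_ne_zero : (y : V) ≠ 0 := by
    simpa using y_notMem ⊥ (Finset.mem_insert_self ⊥ B)
  have infinite_multiples : ((fun t : K => t • (y : V)) '' {0}ᶜ).Infinite :=
    (Set.finite_singleton 0).infinite_compl.image (smul_left_injective K y_ne_zero).injOn
  obtain ⟨_, ⟨t, ht, rfl⟩, htE⟩ := infinite_multiples.exists_notMem_finset E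
  exact ⟨t • (y : V), W.smul_mem t y.2,
    fun U hU h => y_notMem U (Finset.mem_insert_of_mem hU) ((U.smul_mem_iff ht).1 h), htE⟩

end LinearAlgebra

section AtomSpan

variable {K n α : Type*} [CommRing K]

/-- The span of the atoms (columns) of the dictionary `D` with indices in `S`. -/
def atomSpan (D : Matrix n α K) (S : Set α) : Submodule K (n → K) :=
  Submodule.span K (D.col '' S)

variable [Fintype α] {D : Matrix n α K} {S : Set α}

theorem linearCombination_col (D : Matrix n α K) (v : α →₀ K) :
    Finsupp.linearCombination K D.col v = D *ᵥ v := by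
  ext i
  simp [Finsupp.linearCombination_apply, Finsupp.sum_fintype, mulVec, dotProduct, mul_comm]

theorem mem_atomSpan {y : n → K} :
    y ∈ atomSpan D S ↔ ∃ v : α → K, Function.support v ⊆ S ∧ D *ᵥ v = y := by
  rw [atomSpan, Finsupp.mem_span_image_iff_linearCombination,
    Finsupp.equivFunOnFinite.exists_congr_left]
  simp [linearCombination_col, Finsupp.mem_supported]

theorem linearIndepOn_col_iff :
    LinearIndepOn K D.col S ↔ ∀ v : α → K, Function.support v ⊆ S → D *ᵥ v = 0 → v = 0 := by
  rw [linearIndepOn_iff, Finsupp.equivFunOnFinite.forall_congr_left]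
  simp [linearCombination_col, Finsupp.mem_supported, DFunLike.ext'_iff]

theorem mulVec_eq_smul_col_of_support_subset {v : α → K} {m : α}
    (hv : Function.support v ⊆ {m}) : D *ᵥ v = v m • D.col m := by
  ext i
  rw [mulVec, dotProduct, Fintype.sum_eq_single m]
  · simp [mul_comm]
  · intro k hk
    rw [Function.notMem_support.1 fun h => hk (hv h), mul_zero]

end AtomSpan

section Hamming

variable {K α : Type*} [Zero K] [DecidableEq K] [Fintype α]

theorem hammingNorm_eq_ncard_support (v : α → K) :
    hammingNorm v = (Function.support v).ncard := by
  rw [hammingNorm, ← Set.ncard_coe_finset]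
  simp [Function.support]

theorem hammingNorm_eq_card_of_support_eq {v : α → K} {S : Finset α}
    (hv : Function.support v = S) : hammingNorm v = #S := by
  rw [hammingNorm_eq_ncard_support, hv, Set.ncard_coe_finset]

theorem hammingNorm_le_card_of_support_subset {v : α → K} {S : Finset α}
    (hv : Function.support v ⊆ S) : hammingNorm v ≤ #S := by
  rw [hammingNorm_eq_ncard_support, ← Set.ncard_coe_finset]
  exact Set.ncard_le_ncard hv

theorem exists_support_subset_of_hammingNorm_le {v : α → K} {s : ℕ} (hv : hammingNorm v ≤ s)
    (hs : s ≤ Fintype.card α) : ∃ p : Set.powersetCard α s, Function.support v ⊆ p := by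
  obtain ⟨S, hvS, hS⟩ := Finset.exists_superset_card_eq hv hs
  exact ⟨⟨S, hS⟩, fun m hm => hvS (by simpa using hm)⟩

end Hamming

section SparseInjective

variable {K n α : Type*} [Field K] {s : ℕ}

theorem linearIndepOn_col_iff_finrank_atomSpan_eq {D : Matrix n α K}
    {p : Set.powersetCard α s} :
    LinearIndepOn K D.col (p : Set α) ↔ finrank K (atomSpan D p) = s := by
  rw [← Set.powersetCard.coe_coe, linearIndepOn_finset_iff_finrank_eq,
    Set.powersetCard.card_eq]
  rfl

variable [Fintype α] [DecidableEq K]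

/-- Every vector has at most one code over the dictionary `D` with at most `s` nonzero entries.
This is what the condition `s < spark D / 2` is good for. -/
def SparseInjective (s : ℕ) (D : Matrix n α K) : Prop :=
  Set.InjOn D.mulVec {v | hammingNorm v ≤ s}

variable {D D' : Matrix n α K} {p q : Set.powersetCard α s} {v : α → K}

theorem hammingNorm_le_of_support_subset (hv : Function.support v ⊆ p) : hammingNorm v ≤ s :=
  (hammingNorm_le_card_of_support_subset hv).trans_eq (Set.powersetCard.card_eq p)

theorem SparseInjective.linearIndepOn_col (hD : SparseInjective s D)
    (p : Set.powersetCard α s) : LinearIndepOn K D.col (p : Set α) := by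
  rw [linearIndepOn_col_iff]
  intro v hv hDv
  exact hD (hammingNorm_le_of_support_subset hv) (by simp) (by simpa using hDv)

theorem SparseInjective.finrank_atomSpan (hD : SparseInjective s D)
    (p : Set.powersetCard α s) : finrank K (atomSpan D p) = s :=
  linearIndepOn_col_iff_finrank_atomSpan_eq.1 (hD.linearIndepOn_col p)

theorem SparseInjective.support_subset_of_mulVec_mem (hD : SparseInjective s D)
    (hv : hammingNorm v ≤ s) (h : D *ᵥ v ∈ atomSpan D p) : Function.support v ⊆ p := by
  obtain ⟨w, hw, hDw⟩ := mem_atomSpan.1 h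
  rwa [hD hv (hammingNorm_le_of_support_subset hw) hDw.symm]

theorem SparseInjective.eq_of_mulVec_mem (hD : SparseInjective s D)
    (hv : Function.support v = q) (h : D *ᵥ v ∈ atomSpan D p) : q = p := by
  rw [Set.powersetCard.eq_iff_subset, ← Finset.coe_subset, Set.powersetCard.coe_coe, ← hv]
  exact hD.support_subset_of_mulVec_mem (hammingNorm_le_of_support_subset hv.subset) h

theorem SparseInjective.eq_of_mul_eq {l : Type*} (hD : SparseInjective s D) {X X' : Matrix α l K}
    (hX : ∀ i, hammingNorm (X.col i) ≤ s) (hX' : ∀ i, hammingNorm (X'.col i) ≤ s)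
    (h : D * X = D * X') : X = X' := by
  ext m i
  exact congrFun (hD (hX i) (hX' i) (congrFun (congrArg col h) i)) m

theorem SparseInjective.exists_perm_smul_col (hD : SparseInjective s D) (hs : 0 < s)
    (hsα : s < Fintype.card α) {φ : Set.powersetCard α s → Set.powersetCard α s}
    (hφ : Function.Injective φ)
    (hspan : ∀ p : Set.powersetCard α s, atomSpan D' p = atomSpan D (φ p)) :
    ∃ (σ : Equiv.Perm α) (c : α → K), (∀ m, c m ≠ 0) ∧ ∀ m, D'.col m = c m • D.col (σ m) := by
  classical
  have col_mem {m : α} {p : Set.powersetCard α s} (hm : m ∈ p) :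
      D'.col m ∈ atomSpan D (φ p) := hspan p ▸ Submodule.subset_span ⟨m, hm, rfl⟩
  have exists_mem : ∀ m, ∃ p : Set.powersetCard α s, m ∈ p := by
    intro m
    obtain ⟨S, hmS, hS⟩ := Finset.exists_superset_card_eq (s := {m}) hs hsα.le
    exact ⟨⟨S, hS⟩, hmS (Finset.mem_singleton_self m)⟩
  have col_ne_zero : ∀ m, D'.col m ≠ 0 := by
    intro m
    obtain ⟨p, hm⟩ := exists_mem m
    refine (linearIndepOn_col_iff_finrank_atomSpan_eq.2 ?_).ne_zero hm
    rw [hspan, hD.finrank_atomSpan]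
  have exists_code : ∀ m, ∃ v : α → K, hammingNorm v ≤ s ∧ D *ᵥ v = D'.col m := by
    intro m
    obtain ⟨p, hm⟩ := exists_mem m
    obtain ⟨v, hv, hDv⟩ := mem_atomSpan.1 (col_mem hm)
    exact ⟨v, hammingNorm_le_of_support_subset hv, hDv⟩
  choose v hv hDv using exists_code
  have support_nonempty : ∀ m, (Function.support (v m)).Nonempty := by
    intro m
    rw [Function.support_nonempty_iff]
    intro h
    exact col_ne_zero m (by rw [← hDv, h, mulVec_zero])
  obtain ⟨σ, hσ⟩ := exists_perm_forall_eq_singleton hs (hsα.trans_eq Nat.card_eq_fintype_card.symm)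
    hφ support_nonempty fun m p hm k hk =>
      hD.support_subset_of_mulVec_mem (hv m) (hDv m ▸ col_mem hm) hk
  refine ⟨σ, fun m => v m (σ m), fun m => ?_, fun m => ?_⟩
  · rw [← Function.mem_support, hσ]
    rfl
  · rw [← hDv, mulVec_eq_smul_col_of_support_subset (hσ m).subset]

end SparseInjective

section Spark

variable {N M s : ℕ} {D : Matrix (Fin N) (Fin M) ℝ}

theorem linearIndepOn_col_of_card_lt_spark {S : Finset (Fin M)} (hS : (#S : ℕ∞) < spark D) :
    LinearIndepOn ℝ D.col (S : Set (Fin M)) := by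
  by_contra h
  exact hS.not_ge (sInf_le ⟨S, rfl, h⟩)

theorem sparseInjective_of_two_mul_lt_spark (hD : 2 * (s : ℕ∞) < spark D) :
    SparseInjective s D := by
  intro v hv w hw h
  let S : Finset (Fin M) := {m | (-v + w) m ≠ 0}
  have card_le : #S ≤ 2 * s :=
    calc #S = hammingDist v w := (hammingDist_eq_hammingNorm v w).symm
      _ ≤ hammingNorm v + hammingNorm w := by
        simpa using hammingDist_triangle v 0 w
      _ ≤ 2 * s := two_mul s ▸ add_le_add hv hw
  have indep := linearIndepOn_col_of_card_lt_spark (S := S)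
    (lt_of_le_of_lt (by exact_mod_cast card_le) hD)
  have sub_eq_zero : -v + w = 0 := linearIndepOn_col_iff.1 indep _ (by intro m; simp [S])
    (by rw [mulVec_add, mulVec_neg, h, neg_add_cancel])
  exact neg_add_eq_zero.1 sub_eq_zero

end Spark

theorem exists_injective_atomSpan_eq {K n α ι : Type*} [Field K] [Finite α]
    [DecidableEq α] [Fintype ι] {s : ℕ} (hs : 0 < s) {D D' : Matrix n α K}
    {f g : ι → Set.powersetCard α s} {y : ι → n → K}
    (hf : ∀ i, y i ∈ atomSpan D (f i)) (hg : ∀ i, y i ∈ atomSpan D' (g i))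
    (hfiber : ∀ p, #{i | f i = p} = s + 1)
    (hrank : ∀ I : Finset ι, #I = s + 1 →
      ((∀ i ∈ I, ∀ k ∈ I, f i = f k) → Set.finrank K (y '' I) = s) ∧
      ((¬ ∀ i ∈ I, ∀ k ∈ I, f i = f k) → Set.finrank K (y '' I) = s + 1)) :
    ∃ φ : Set.powersetCard α s → Set.powersetCard α s, Function.Injective φ ∧
      ∀ p : Set.powersetCard α s, atomSpan D' p = atomSpan D (φ p) := by
  have f_eq_of_g_eq (I : Finset ι) (hI : #I = s + 1) (hgI : ∀ i ∈ I, ∀ k ∈ I, g i = g k) :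
      ∀ i ∈ I, ∀ k ∈ I, f i = f k := by
    by_contra hne
    obtain ⟨i, hi⟩ := Finset.card_pos.1 (hI.symm ▸ s.succ_pos : 0 < #I)
    have rank_le : Set.finrank K (y '' I) ≤ #(g i).1 :=
      finrank_image_le_card_of_forall_mem_span fun k hk => hgI k hk i hi ▸ hg k
    rw [(hrank I hI).2 hne, Set.powersetCard.card_eq] at rank_le
    omega
  obtain ⟨φ, hφ, f_eq⟩ := exists_injective_forall_eq_apply (by omega) hfiber f_eq_of_g_eq
  refine ⟨φ, hφ, fun p => ?_⟩
  let I : Finset ι := {i | f i = φ p}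
  have f_eq_of_mem {i} (hi : i ∈ I) : f i = φ p := (Finset.mem_filter_univ i).1 hi
  have g_eq_of_mem {i} (hi : i ∈ I) : g i = p := hφ ((f_eq i).symm.trans (f_eq_of_mem hi))
  have rank_I : Set.finrank K (y '' I) = s := (hrank I (hfiber _)).1 fun i hi k hk =>
    (f_eq_of_mem hi).trans (f_eq_of_mem hk).symm
  calc atomSpan D' p = Submodule.span K (y '' I) :=
        (span_image_eq_span_image_of_finrank_eq (S := p.1) (fun i hi => g_eq_of_mem hi ▸ hg i)
          (rank_I.trans (Set.powersetCard.card_eq p).symm)).symm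
    _ = atomSpan D (φ p) :=
        span_image_eq_span_image_of_finrank_eq (S := (φ p).1) (fun i hi => f_eq_of_mem hi ▸ hf i)
          (rank_I.trans (Set.powersetCard.card_eq (φ p)).symm)

section PermScaling

variable {R n α : Type*} [CommRing R] [Fintype α] [DecidableEq α]

theorem eq_mul_permMatrix_mul_diagonal {D D' : Matrix n α R} {σ : Equiv.Perm α} {c : α → R}
    (h : ∀ m, D'.col m = c m • D.col (σ m)) :
    D' = D * (σ⁻¹.permMatrix R * diagonal c) := by
  rw [← Matrix.mul_assoc, Equiv.Perm.permMatrix, PEquiv.mul_toMatrix_toPEquiv]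
  ext i m
  simpa [mul_comm, ← Equiv.Perm.inv_def] using congrFun (h m) i

theorem hammingNorm_permMatrix_mulVec [DecidableEq R] (σ : Equiv.Perm α) (v : α → R) :
    hammingNorm (σ.permMatrix R *ᵥ v) = hammingNorm v := by
  rw [permMatrix_mulVec, hammingNorm_eq_ncard_support, hammingNorm_eq_ncard_support,
    Function.support_comp_eq_preimage, Set.ncard_preimage_of_injective_subset_range σ.injective]
  simp

theorem hammingNorm_diagonal_mulVec_le [DecidableEq R] (c v : α → R) :
    hammingNorm (diagonal c *ᵥ v) ≤ hammingNorm v := by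
  simp_rw [funext (mulVec_diagonal c v)]
  exact hammingNorm_comp_le_hammingNorm (fun m => (c m * ·)) fun m => mul_zero (c m)

end PermScaling

section Uniqueness

variable {N M L s : ℕ} {D D' : Matrix (Fin N) (Fin M) ℝ} {Y : Matrix (Fin N) (Fin L) ℝ}
  {X X' : Matrix (Fin M) (Fin L) ℝ}

theorem Assumptions.sparseInjective (h : Assumptions s D X) : SparseInjective s D :=
  sparseInjective_of_two_mul_lt_spark h.1.2

theorem RichnessAssumption.exists_samples (h : RichnessAssumption s Y X) :
    ∃ t : Set.powersetCard (Fin M) s × Fin (s + 1) → Fin L,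
      (∀ p, Function.Injective fun k => Y.col (t (p, k))) ∧
      ∀ q, Function.support (X.col (t q)) = q.1 := by
  have exists_embedding (p : Set.powersetCard (Fin M) s) :
      Nonempty (Fin (s + 1) ↪ Y.col '' {i | Function.support (X.col i) = (p : Set (Fin M))}) := by
    have := Fintype.ofFinite (Y.col '' {i | Function.support (X.col i) = (p : Set (Fin M))})
    refine Function.Embedding.nonempty_of_card_le ?_
    simpa [Set.ncard_eq_toFinset_card'] using h p (Set.powersetCard.card_eq p)
  let e p := (exists_embedding p).some
  choose t support_t col_t using fun q : Set.powersetCard (Fin M) s × Fin (s + 1) =>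
    (e q.1 q.2).2
  refine ⟨t, fun p k l hkl => (e p).injective (Subtype.ext ?_), support_t⟩
  rw [← col_t (p, k), ← col_t (p, l)]
  exact hkl

theorem RichnessAssumption.le_card (h : RichnessAssumption s Y X) :
    (s + 1) * M.choose s ≤ L := by
  obtain ⟨t, injective_col_t, support_t⟩ := h.exists_samples
  have injective_t : Function.Injective t := by
    rintro ⟨p, k⟩ ⟨q, l⟩ htt
    obtain rfl : p = q := by
      simpa [htt, support_t (q, l)] using (support_t (p, k)).symm
    rw [injective_col_t p (congrArg Y.col htt)]
  have card_le := Nat.card_le_card_of_injective t injective_t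
  rwa [Nat.card_prod, Set.powersetCard.card, Nat.card_fin, Nat.card_fin, Nat.card_fin,
    mul_comm] at card_le

theorem Assumptions.exists_samples (h : Assumptions s D X) :
    ∃ t : Set.powersetCard (Fin M) s × Fin (s + 1) → Fin L,
      Function.Injective (fun q => (D * X).col (t q)) ∧
      ∀ q, Function.support (X.col (t q)) = q.1 := by
  obtain ⟨t, injective_col_t, support_t⟩ := h.2.1.exists_samples
  refine ⟨t, ?_, support_t⟩
  rintro ⟨p, k⟩ ⟨q, l⟩ hpq
  have code_eq : X.col (t (p, k)) = X.col (t (q, l)) :=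
    h.sparseInjective (h.1.1 _).le (h.1.1 _).le hpq
  obtain rfl : p = q := by
    simpa [code_eq, support_t (q, l)] using (support_t (p, k)).symm
  rw [injective_col_t p hpq]

theorem sameAtoms_map_iff {κ : Type*} {t : κ ↪ Fin L} {f : κ → Set.powersetCard (Fin M) s}
    (ht : ∀ q, Function.support (X.col (t q)) = f q) {I : Finset κ} :
    SameAtoms X (I.map t) ↔ ∀ i ∈ I, ∀ k ∈ I, f i = f k := by
  simp [SameAtoms, ht]

theorem NondegeneracyAssumption.finrank_image {κ : Type*} {t : κ → Fin L}
    {f : κ → Set.powersetCard (Fin M) s} (h : NondegeneracyAssumption s Y X)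
    (hY : Function.Injective fun q => Y.col (t q))
    (ht : ∀ q, Function.support (X.col (t q)) = f q) {I : Finset κ} (hI : #I = s + 1) :
    ((∀ i ∈ I, ∀ k ∈ I, f i = f k) → Set.finrank ℝ ((fun q => Y.col (t q)) '' I) = s) ∧
      ((¬ ∀ i ∈ I, ∀ k ∈ I, f i = f k) →
        Set.finrank ℝ ((fun q => Y.col (t q)) '' I) = s + 1) := by
  let τ : κ ↪ Fin L := ⟨t, hY.of_comp⟩
  have injOn : Set.InjOn Y.col (I.map τ) := by
    rw [Finset.coe_map]
    exact hY.injOn.image_of_comp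
  have rank := h (I.map τ) ((I.card_map τ).trans hI) injOn
  rw [sameAtoms_map_iff ht, Finset.coe_map, Set.image_image] at rank
  exact rank

theorem Assumptions.exists_injective_atomSpan_eq (h : Assumptions s D X) (hs : 0 < s)
    (hsM : s ≤ M) (h' : IsSparseFactorization s (D * X) D' X') :
    ∃ φ : Set.powersetCard (Fin M) s → Set.powersetCard (Fin M) s, Function.Injective φ ∧
      ∀ p : Set.powersetCard (Fin M) s, atomSpan D' p = atomSpan D (φ p) := by
  obtain ⟨t, injective_col_t, support_t⟩ := h.exists_samples
  choose g support_subset using fun q => exists_support_subset_of_hammingNorm_le (h'.2 (t q))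
    (hsM.trans_eq (Fintype.card_fin M).symm)
  have card_fiber (p) : #{q : Set.powersetCard (Fin M) s × Fin (s + 1) | q.1 = p} = s + 1 := by
    rw [show Finset.filter _ _ = {p} ×ˢ Finset.univ by ext; simp [Prod.ext_iff, eq_comm]]
    simp
  exact DictLearning.exists_injective_atomSpan_eq hs
    (fun q => mem_atomSpan.2 ⟨_, (support_t q).subset, rfl⟩)
    (fun q => mem_atomSpan.2 ⟨_, support_subset q, (congrFun (congrArg col h'.1) (t q)).symm⟩)
    card_fiber fun I => h.2.2.finrank_image injective_col_t support_t

theorem Assumptions.isUniqueFactorization (h : Assumptions s D X) (hs : 0 < s) (hsM : s < M) :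
    IsUniqueFactorization s (D * X) D X := by
  refine ⟨⟨rfl, fun i => (h.1.1 i).le⟩, fun D' X' h' => ?_⟩
  obtain ⟨φ, hφ, hspan⟩ := h.exists_injective_atomSpan_eq hs hsM.le h'
  obtain ⟨σ, c, hc, hcol⟩ :=
    h.sparseInjective.exists_perm_smul_col hs (by simpa using hsM) hφ hspan
  have hD' := eq_mul_permMatrix_mul_diagonal hcol
  refine ⟨_, ⟨σ⁻¹, c, hc, rfl⟩, hD', h.sparseInjective.eq_of_mul_eq
    (fun i => (h.1.1 i).le) (fun i => ?_) ?_⟩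
  · calc hammingNorm ((σ⁻¹.permMatrix ℝ * diagonal c * X').col i)
        = hammingNorm (σ⁻¹.permMatrix ℝ *ᵥ (diagonal c *ᵥ X'.col i)) := by
          rw [mulVec_mulVec]; rfl
      _ = hammingNorm (diagonal c *ᵥ X'.col i) := hammingNorm_permMatrix_mulVec _ _
      _ ≤ hammingNorm (X'.col i) := hammingNorm_diagonal_mulVec_le _ _
      _ ≤ s := h'.2 i
  · rw [← Matrix.mul_assoc, ← hD', h'.1]

end Uniqueness

section GeneralPosition

variable {K n α ι : Type*} [Field K] [Fintype α] {s : ℕ} {D : Matrix n α K}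
  {f : ι → Set.powersetCard α s} {x x' : ι → α → K} {A : Finset ι} {a : ι}

/-- The codes `x i`, `i ∈ A`, have the prescribed supports `f i`, and the data points `D *ᵥ x i` are
in general position: they are distinct, and any `s + 1` or fewer of them are linearly independent
unless they are `s + 1` points with the same prescribed support. -/
structure GenericCodes (D : Matrix n α K) (f : ι → Set.powersetCard α s) (x : ι → α → K)
    (A : Finset ι) : Prop where
  support_eq : ∀ i ∈ A, Function.support (x i) = f i
  injOn : Set.InjOn (fun i => D *ᵥ x i) A
  linearIndepOn : ∀ I ⊆ A, #I ≤ s + 1 → (#I = s + 1 → ¬ ∀ i ∈ I, ∀ k ∈ I, f i = f k) →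
    LinearIndepOn K (fun i => D *ᵥ x i) (I : Set ι)

theorem GenericCodes.congr (h : GenericCodes D f x A) (hx : ∀ i ∈ A, x i = x' i) :
    GenericCodes D f x' A where
  support_eq i hi := hx i hi ▸ h.support_eq i hi
  injOn := h.injOn.congr fun i hi => congrArg _ (hx i hi)
  linearIndepOn I hI hcard hne :=
    (h.linearIndepOn I hI hcard hne).congr fun i hi => congrArg _ (hx i (hI hi))

theorem GenericCodes.finrank_image (h : GenericCodes D f x A) {I : Finset ι} (hIA : I ⊆ A)
    (hI : #I = s + 1) :
    ((∀ i ∈ I, ∀ k ∈ I, f i = f k) →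
      Set.finrank K ((fun i => D *ᵥ x i) '' (I : Set ι)) = s) ∧
    ((¬ ∀ i ∈ I, ∀ k ∈ I, f i = f k) →
      Set.finrank K ((fun i => D *ᵥ x i) '' (I : Set ι)) = s + 1) := by
  classical
  refine ⟨fun hf => le_antisymm ?_ ?_, fun hf => ?_⟩
  · obtain ⟨k, hk⟩ := Finset.card_pos.1 (hI.symm ▸ s.succ_pos : 0 < #I)
    rw [← Set.powersetCard.card_eq (f k)]
    exact finrank_image_le_card_of_forall_mem_span fun i hi =>
      mem_atomSpan.2 ⟨x i, (hf i hi k hk ▸ h.support_eq i (hIA hi)).subset, rfl⟩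
  · obtain ⟨Q, hQI, hQ⟩ := Finset.exists_subset_card_eq (show s ≤ #I by omega)
    have indep := h.linearIndepOn Q (hQI.trans hIA) (by omega) (by omega)
    have := FiniteDimensional.span_of_finite K (I.finite_toSet.image fun i => D *ᵥ x i)
    calc s = Set.finrank K ((fun i => D *ᵥ x i) '' (Q : Set ι)) :=
          hQ ▸ (linearIndepOn_finset_iff_finrank_eq.1 indep).symm
      _ ≤ Set.finrank K ((fun i => D *ᵥ x i) '' (I : Set ι)) :=
          Submodule.finrank_mono (Submodule.span_mono (Set.image_mono hQI))
  · rw [← hI]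
    exact linearIndepOn_finset_iff_finrank_eq.1 (h.linearIndepOn I hIA hI.le fun _ => hf)

variable [DecidableEq K]

theorem exists_code_avoiding [Infinite K] (hD : SparseInjective s D) (hs : 0 < s)
    (p : Set.powersetCard α s) {B : Finset (Submodule K (n → K))}
    (hB : ∀ U ∈ B, ¬ atomSpan D p ≤ U) (E : Finset (n → K)) :
    ∃ v : α → K, Function.support v = p ∧ (∀ U ∈ B, D *ᵥ v ∉ U) ∧ D *ᵥ v ∉ E := by
  classical
  have ne_bot : atomSpan D p ≠ ⊥ := by
    intro h
    have rank := hD.finrank_atomSpan p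
    rw [h, finrank_bot] at rank
    exact hs.ne rank
  have not_le_face : ∀ m ∈ p, ¬ atomSpan D p ≤ atomSpan D (p \ {m} : Set α) := fun m hm hle =>
    linearIndepOn_iff_notMem_span.1 (hD.linearIndepOn_col p) m hm
      (hle (Submodule.subset_span ⟨m, hm, rfl⟩))
  obtain ⟨_, hy, y_notMem, hyE⟩ := exists_mem_forall_notMem ne_bot
    (B := B ∪ p.1.image fun m => atomSpan D (p \ {m} : Set α)) (by
      simp only [Finset.mem_union, Finset.mem_image]
      rintro _ (hU | ⟨m, hm, rfl⟩)
      exacts [hB _ hU, not_le_face m hm]) E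
  obtain ⟨v, hv, rfl⟩ := mem_atomSpan.1 hy
  refine ⟨v, hv.antisymm fun m hm hvm => ?_,
    fun U hU => y_notMem U (Finset.mem_union_left _ hU), hyE⟩
  exact y_notMem _ (Finset.mem_union_right _ (Finset.mem_image_of_mem _ hm))
    (mem_atomSpan.2 ⟨v, Set.subset_sdiff_singleton hv (not_not.2 hvm), rfl⟩)

theorem GenericCodes.card_eq_and_eq_of_atomSpan_le (h : GenericCodes D f x A)
    (hD : SparseInjective s D) {Q : Finset ι} (hQA : Q ⊆ A) (hQ : #Q ≤ s)
    {p : Set.powersetCard α s}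
    (hle : atomSpan D p ≤ Submodule.span K ((fun i => D *ᵥ x i) '' (Q : Set ι))) :
    #Q = s ∧ ∀ i ∈ Q, f i = p := by
  have := FiniteDimensional.span_of_finite K (Q.finite_toSet.image fun i => D *ᵥ x i)
  have rank_le : finrank K (Submodule.span K ((fun i => D *ᵥ x i) '' (Q : Set ι))) ≤
      finrank K (atomSpan D p) :=
    (finrank_image_finset_le _ Q).trans (hQ.trans_eq (hD.finrank_atomSpan p).symm)
  have span_eq := Submodule.eq_of_le_of_finrank_le hle rank_le
  refine ⟨hQ.antisymm ?_, fun i hi => ?_⟩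
  · rw [← hD.finrank_atomSpan p, span_eq]
    exact finrank_image_finset_le _ Q
  · refine hD.eq_of_mulVec_mem (h.support_eq i (hQA hi)) ?_
    rw [span_eq]
    exact Submodule.subset_span ⟨i, hi, rfl⟩

theorem GenericCodes.insert [DecidableEq ι] (h : GenericCodes D f x A) (hD : SparseInjective s D)
    (hsupp : Function.support (x a) = f a) (hnew : D *ᵥ x a ∉ (fun i => D *ᵥ x i) '' (A : Set ι))
    (hspan : ∀ Q ⊆ A,
      ¬ atomSpan D (f a) ≤ Submodule.span K ((fun i => D *ᵥ x i) '' (Q : Set ι)) →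
        D *ᵥ x a ∉ Submodule.span K ((fun i => D *ᵥ x i) '' (Q : Set ι))) :
    GenericCodes D f x (insert a A) where
  support_eq := Finset.forall_mem_insert .. |>.2 ⟨hsupp, h.support_eq⟩
  injOn := by
    rw [Finset.coe_insert, Set.injOn_insert fun ha => hnew ⟨a, ha, rfl⟩]
    exact ⟨h.injOn, hnew⟩
  linearIndepOn I hI hcard hne := by
    by_cases ha : a ∈ I
    · obtain ⟨Q, haQ, rfl⟩ : ∃ Q, a ∉ Q ∧ Insert.insert a Q = I :=
        ⟨I.erase a, Finset.notMem_erase a I, Finset.insert_erase ha⟩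
      rw [Finset.card_insert_of_notMem haQ] at hcard hne
      have hQA : Q ⊆ A := (Finset.insert_subset_insert_iff haQ).1 hI
      rw [Finset.coe_insert, linearIndepOn_insert (Finset.mem_coe.not.2 haQ)]
      refine ⟨h.linearIndepOn Q hQA (by omega) (by omega), hspan Q hQA fun hle => ?_⟩
      obtain ⟨hQ, hfQ⟩ := h.card_eq_and_eq_of_atomSpan_le hD hQA (by omega) hle
      have hfI : ∀ i ∈ Insert.insert a Q, f i = f a := Finset.forall_mem_insert .. |>.2 ⟨rfl, hfQ⟩
      exact hne (by omega) fun i hi k hk => (hfI i hi).trans (hfI k hk).symm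
    · exact h.linearIndepOn I ((Finset.subset_insert_iff_of_notMem ha).1 hI) hcard hne

theorem exists_genericCodes [Infinite K] (hD : SparseInjective s D) (hs : 0 < s)
    (f : ι → Set.powersetCard α s) (A : Finset ι) : ∃ x, GenericCodes D f x A := by
  classical
  induction A using Finset.induction_on with
  | empty =>
    exact ⟨0, by simp, by simp, fun I hI _ _ => by simp [Finset.subset_empty.1 hI]⟩
  | insert a A ha ih =>
    obtain ⟨x, hx⟩ := ih
    let spanOf (Q : Finset ι) := Submodule.span K ((fun i => D *ᵥ x i) '' (Q : Set ι))
    obtain ⟨v, support_v, v_notMem, v_new⟩ := exists_code_avoiding hD hs (f a)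
      (B := (A.powerset.image spanOf).filter fun U => ¬ atomSpan D (f a) ≤ U)
      (fun U hU => (Finset.mem_filter.1 hU).2) (A.image fun i => D *ᵥ x i)
    have update_eq {i} (hi : i ∈ A) : Function.update x a v i = x i :=
      Function.update_of_ne (ne_of_mem_of_not_mem hi ha) v x
    have image_eq {Q} (hQ : Q ⊆ A) : (fun i => D *ᵥ Function.update x a v i) '' (Q : Set ι) =
        (fun i => D *ᵥ x i) '' (Q : Set ι) :=
      Set.image_congr fun i hi => congrArg _ (update_eq (hQ hi))
    refine ⟨Function.update x a v, (hx.congr fun i hi => (update_eq hi).symm).insert hD ?_ ?_ ?_⟩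
    · rwa [Function.update_self]
    · rwa [Function.update_self, image_eq subset_rfl, ← Finset.coe_image, Finset.mem_coe]
    · intro Q hQ hle
      rw [image_eq hQ] at hle ⊢
      rw [Function.update_self]
      exact v_notMem _ (Finset.mem_filter.2
        ⟨Finset.mem_image_of_mem _ (Finset.mem_powerset.2 hQ), hle⟩)

end GeneralPosition

section Sharpness

variable {N M L s : ℕ}

theorem exists_assumptions_of_succ_le_card_fiber {D : Matrix (Fin N) (Fin M) ℝ} (hs : 0 < s)
    (hD : 2 * (s : ℕ∞) < spark D) (f : Fin L → Set.powersetCard (Fin M) s)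
    (hf : ∀ p, s + 1 ≤ #{i | f i = p}) :
    ∃ X : Matrix (Fin M) (Fin L) ℝ,
      (∀ i, Function.support (X.col i) = f i) ∧ Assumptions s D X := by
  obtain ⟨x, hx⟩ := exists_genericCodes (sparseInjective_of_two_mul_lt_spark hD) hs f Finset.univ
  have support_eq : ∀ i, Function.support ((of x)ᵀ.col i) = f i :=
    fun i => hx.support_eq i (Finset.mem_univ i)
  have injective_col : Function.Injective (D * (of x)ᵀ).col := by
    rw [← Set.injOn_univ, ← Finset.coe_univ]
    exact hx.injOn
  refine ⟨(of x)ᵀ, support_eq, ⟨fun i => ?_, hD⟩, fun S hS => ?_, fun I hI _ => ?_⟩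
  · rw [hammingNorm_eq_card_of_support_eq (support_eq i), Set.powersetCard.card_eq]
  · have generated_eq : {i | Function.support ((of x)ᵀ.col i) = (S : Set (Fin M))} =
        ({i | f i = ⟨S, hS⟩} : Finset (Fin L)) := by
      ext i
      rw [Set.mem_ofPred_eq, support_eq, ← Set.powersetCard.coe_coe, Finset.coe_inj]
      simp [Subtype.ext_iff]
    rw [Set.ncard_image_of_injective _ injective_col, generated_eq, Set.ncard_coe_finset]
    exact hf ⟨S, hS⟩
  · have same_iff := sameAtoms_map_iff (t := .refl _) support_eq (I := I)
    rw [Finset.map_refl] at same_iff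
    rw [same_iff]
    exact hx.finrank_image (Finset.subset_univ I) hI

theorem exists_forall_succ_le_card_fiber (M s : ℕ) :
    ∃ f : Fin ((s + 1) * M.choose s) → Set.powersetCard (Fin M) s,
      ∀ p, s + 1 ≤ #{i | f i = p} := by
  have card_eq : Nat.card (Set.powersetCard (Fin M) s × Fin (s + 1)) =
      (s + 1) * M.choose s := by
    rw [Nat.card_prod, Set.powersetCard.card, Nat.card_fin, Nat.card_fin, mul_comm]
  let e := Finite.equivFinOfCardEq card_eq
  refine ⟨fun i => (e.symm i).1, fun p => ?_⟩
  calc s + 1 = #(Finset.univ : Finset (Fin (s + 1))) := (Finset.card_fin _).symm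
    _ ≤ #{i | (e.symm i).1 = p} :=
      Finset.card_le_card_of_injOn (fun k => e (p, k)) (by simp [Set.MapsTo])
        fun k _ l _ hkl => by simpa using hkl

end Sharpness

end DictLearning

theorem mainTheorem10 (J M s : ℕ) (N : Fin J → ℕ) (hs : 0 < s) (hsM : s < M)
    (D : (j : Fin J) → Matrix (Fin (N j)) (Fin M) ℝ) :
    (∀ (L : ℕ) (X : Fin J → Matrix (Fin M) (Fin L) ℝ)
        (Y : (j : Fin J) → Matrix (Fin (N j)) (Fin L) ℝ),
      (∀ j, Y j = D j * X j) → (∀ j, DictLearning.Assumptions s (D j) (X j)) →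
        (∀ j, DictLearning.IsUniqueFactorization s (Y j) (D j) (X j)) ∧
          J * ((s + 1) * M.choose s) ≤ J * L) ∧
    ((∀ j, 2 * (s : ℕ∞) < DictLearning.spark (D j)) →
      IsLeast {n : ℕ | ∃ (L : ℕ) (X : Fin J → Matrix (Fin M) (Fin L) ℝ),
          n = J * L ∧ DictLearning.CommonSparsityProfile X ∧
            ∀ j, DictLearning.Assumptions s (D j) (X j)}
        (J * ((s + 1) * M.choose s))) := by
  have hlower : ∀ (L : ℕ) (X : Fin J → Matrix (Fin M) (Fin L) ℝ),
      (∀ j, DictLearning.Assumptions s (D j) (X j)) →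
        J * ((s + 1) * M.choose s) ≤ J * L := by
    intro L X h
    rcases Nat.eq_zero_or_pos J with rfl | hJ
    · simp
    · exact Nat.mul_le_mul_left J (h ⟨0, hJ⟩).2.1.le_card
  refine ⟨fun L X Y hY h => ⟨fun j => ?_, hlower L X h⟩, fun hD => ⟨?_, ?_⟩⟩
  · rw [hY j]
    exact (h j).isUniqueFactorization hs hsM
  · obtain ⟨f, hf⟩ := DictLearning.exists_forall_succ_le_card_fiber M s
    choose X hX hA using fun j =>
      DictLearning.exists_assumptions_of_succ_le_card_fiber hs (hD j) f hf
    exact ⟨_, X, rfl, fun i j j' => (hX j i).trans (hX j' i).symm, hA⟩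
  · rintro n ⟨L, X, rfl, -, h⟩
    exact hlower L X h
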